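/- There is a universal constant $C>0$ such that the following holds for every dimension $n$. Let $\mu$ be an origin-symmetric log-concave probability measure on $\mathbb{R}^n$, i.e. $\mu(A)=\mu(-A)$ for all Borel sets $A$ and $d\mu = e^{-V(x)}\,dx$ with $V:\mathbb{R}^n\to\mathbb{R}\cup\{+\infty\}$ convex, and let $L\subset\mathbb{R}^n$ be a star-body, i.e. a compact set with the origin in its interior such that $sL\subset L$ for all $s\in[0,1]$. For $q>0$ put $m_q(\mu,L)=\sup\{s>0 : \mu(sL)\le e^{-q}\}$. Let $Z_p(\mu)$ be the $L_p$-centroid body of $\mu$, the compact convex set with support function $\theta\mapsto\left(\int|\langle x,\theta\rangle|^p\,d\mu(x)\right)^{1/p}$, and for sets $A,B\subset\mathbb{R}^n$ let $M(A,B)$ be the packing number, the maximal number of points $x_i\in A$ such that the sets $x_i+B$ are mutually disjoint. Then for every real $p\ge n$, $$M\bigl(Z_p(\mu),\,C\,t\,m_q(\mu,L)\,L\bigr)\le\exp\Bigl(1+q+\frac{p}{t}\Bigr)\qquad\text{for all } t,q>0.$$ In particular, if $\mu(L)\ge e^{-p}$ with $p\ge n$, then $M(Z_p(\mu),\,C L)\le\exp(3p)$.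 -/

import Mathlib

open MeasureTheory Set
open scoped Pointwise ENNReal

namespace CentroidPacking

/-- `μ = exp (-V) dx` for a convex `V : ℝⁿ → ℝ ∪ {+∞}`. The extended-valued convex function is given
by the convex set `D` on which it is finite and by its restriction to `D`, a real-valued convex
function; outside `D`, where the value is `+∞`, the density vanishes. -/
def IsLogConcave {n : ℕ} (μ : Measure (EuclideanSpace ℝ (Fin n))) : Prop :=
  ∃ (D : Set (EuclideanSpace ℝ (Fin n))) (V : EuclideanSpace ℝ (Fin n) → ℝ),
    ConvexOn ℝ D V ∧
      μ = volume.withDensity (D.indicator fun x => ENNReal.ofReal (Real.exp (-V x)))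

/-- A star-body: a compact set with the origin in its interior such that `t L ⊆ L` for all
`t ∈ [0, 1]`. -/
structure IsStarBody {n : ℕ} (L : Set (EuclideanSpace ℝ (Fin n))) : Prop where
  isCompact : IsCompact L
  zero_mem_interior : (0 : EuclideanSpace ℝ (Fin n)) ∈ interior L
  smul_subset : ∀ t ∈ Icc (0 : ℝ) 1, t • L ⊆ L

/-- The quantile `m_q(μ, L) = sup {s > 0 ; μ (s L) ≤ exp (-q)}`. -/
noncomputable def quantile {n : ℕ} (q : ℝ) (μ : Measure (EuclideanSpace ℝ (Fin n)))
    (L : Set (EuclideanSpace ℝ (Fin n))) : ℝ :=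
  sSup {s : ℝ | 0 < s ∧ μ (s • L) ≤ ENNReal.ofReal (Real.exp (-q))}

/-- The `L_p` centroid body `Z_p(μ)`, the closed convex set whose support function is
`θ ↦ (∫ |⟨y, θ⟩| ^ p dμ(y)) ^ (1 / p)`. -/
noncomputable def centroidBody {n : ℕ} (p : ℝ) (μ : Measure (EuclideanSpace ℝ (Fin n))) :
    Set (EuclideanSpace ℝ (Fin n)) :=
  {x | ∀ θ : EuclideanSpace ℝ (Fin n),
    inner ℝ x θ ≤ (∫ y, |inner ℝ y θ| ^ p ∂μ) ^ (1 / p)}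

/-- The packing number `M(A, B)`: the largest number of points `x` of `A` (possibly infinite) whose
translates `x + B` are mutually disjoint. -/
noncomputable def packing {n : ℕ} (A B : Set (EuclideanSpace ℝ (Fin n))) : ℕ∞ :=
  ⨆ (S : Set (EuclideanSpace ℝ (Fin n))) (_ : S ⊆ A)
    (_ : S.PairwiseDisjoint fun x => x +ᵥ B), S.encard

end CentroidPacking

/-!
After replacing its density by a geometric mean with the reflected density, `μ` has density
`exp (-V)` for an even convex `V` on an open domain. Let `K` be the sublevel set `V < V 0 + 2 * p`.
If a linear functional `l` is less than `1` in absolute value on `K`, then on `1 ≤ |l|` convexity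
along rays makes `|l y| ^ p * exp (-V y)` at most `exp (-p) * exp (-V (y / 2))`, whose integral is
at most `1` because `2 ^ n ≤ exp p`; hence `∫ |l| ^ p ∂μ ≤ 2`, and Hahn–Banach gives
`Z_p(μ) ⊆ 3 • closure K`.

A homothety of ratio `r` centred at a point where `V ≤ V 0 + 2 * p` decreases the measure of a set
at most by the factor `r ^ n * exp (-2 * p * (1 - r))`. Disjoint translates of a multiple of a set
by points of `Z_p(μ)` shrink to disjoint images of this set under homotheties centred in
`(1 / 3) • Z_p(μ)`, and their measures sum to at most `1`. The ratio `r = 3 * t / (1 + 3 * t)`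
balances the two factors.
-/

namespace CentroidPacking

theorem exp_mul_one_sub_inv_le_pow {n : ℕ} {p r : ℝ} (hnp : n ≤ p) (hr0 : 0 < r) (hr1 : r ≤ 1) :
    Real.exp (p * (1 - r⁻¹)) ≤ r ^ n :=
  have h_nonpos : 1 - r⁻¹ ≤ 0 := sub_nonpos.2 ((one_le_inv₀ hr0).2 hr1)
  calc Real.exp (p * (1 - r⁻¹)) ≤ Real.exp (n * (1 - r⁻¹)) :=
        Real.exp_le_exp.2 (mul_le_mul_of_nonpos_right hnp h_nonpos)
    _ = Real.exp (1 - r⁻¹) ^ n := Real.exp_nat_mul _ _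
    _ ≤ r ^ n := by
        gcongr
        exact (Real.le_log_iff_exp_le hr0).1 (Real.one_sub_inv_le_log_of_pos hr0)

theorem exp_neg_div_le_pow_mul_exp {n : ℕ} {p t r : ℝ} (hnp : n ≤ p) (ht : 0 < t)
    (hr : r = 3 * t / (1 + 3 * t)) :
    Real.exp (-(p / t)) ≤ r ^ n * Real.exp (-(2 * p * (1 - r))) := by
  have hp : 0 ≤ p := n.cast_nonneg.trans hnp
  have hr0 : 0 < r := by rw [hr]; positivity
  have hr1 : r ≤ 1 := by rw [hr, div_le_one (by positivity)]; linarith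
  have h_inv : 1 - r⁻¹ = -(1 / (3 * t)) := by rw [hr]; field_simp; ring
  have h_le : 1 - r ≤ 1 / (3 * t) :=
    calc 1 - r = 1 / (1 + 3 * t) := by rw [hr]; field_simp; ring
      _ ≤ 1 / (3 * t) := by gcongr; linarith
  calc Real.exp (-(p / t))
      = Real.exp (p * (1 - r⁻¹)) * Real.exp (-(2 * p * (1 / (3 * t)))) := by
        rw [h_inv, ← Real.exp_add]
        congr 1
        field_simp
        ring
    _ ≤ r ^ n * Real.exp (-(2 * p * (1 - r))) := by
        gcongr
        exact exp_mul_one_sub_inv_le_pow hnp hr0 hr1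

theorem homothety_smul_image {R M : Type*} [CommRing R] [AddCommGroup M] [Module R M] {c r s : R}
    (hs : (1 - r) * c * s = r) (x : M) (K : Set M) :
    AffineMap.homothety (c • x) r '' K = ((1 - r) * c) • (x +ᵥ s • K) := by
  rw [← image_smul, ← image_vadd, ← image_smul, image_image, image_image]
  refine image_congr fun y _ => ?_
  rw [AffineMap.homothety_eq_lineMap, AffineMap.lineMap_apply_module, vadd_eq_add, smul_add,
    smul_smul, smul_smul, hs]

theorem exists_eq_one_forall_abs_lt_one {E : Type*} [TopologicalSpace E] [AddCommGroup E]
    [IsTopologicalAddGroup E] [Module ℝ E] [ContinuousSMul ℝ E] {K : Set E} (hK : Convex ℝ K)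
    (hK_open : IsOpen K) (h0 : 0 ∈ K) (hneg : ∀ y ∈ K, -y ∈ K) {x : E} (hx : x ∉ K) :
    ∃ l : StrongDual ℝ E, l x = 1 ∧ ∀ y ∈ K, |l y| < 1 := by
  obtain ⟨l, hlx, hl⟩ := separate_convex_open_set h0 hK hK_open hx
  refine ⟨l, hlx, fun y hy => abs_lt.2 ⟨?_, hl y hy⟩⟩
  have := hl (-y) (hneg y hy)
  rw [map_neg] at this
  linarith

section MeasureTheory

theorem encard_mul_le_measure_univ {α ι : Type*} [MeasurableSpace α] (μ : Measure α) {S : Set ι}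
    {A : ι → Set α} (hA : ∀ i, MeasurableSet (A i)) (hd : S.PairwiseDisjoint A) {c : ℝ≥0∞}
    (hc : ∀ i ∈ S, c ≤ μ (A i)) : (S.encard : ℝ≥0∞) * c ≤ μ univ := by
  rw [← ENNReal.tsum_set_const]
  calc ∑' _ : S, c ≤ ∑' i : S, μ (A i) := ENNReal.tsum_le_tsum fun i => hc i i.2
    _ ≤ μ (⋃ i : S, A i) :=
      tsum_meas_le_meas_iUnion_of_disjoint μ (fun i => hA i) fun i j hij =>
        hd i.2 j.2 (Subtype.coe_injective.ne hij)
    _ ≤ μ univ := measure_mono (subset_univ _)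

theorem withDensity_comp_neg {G : Type*} [MeasurableSpace G] [InvolutiveNeg G] [MeasurableNeg G]
    (ν : Measure G) [ν.IsNegInvariant] (f : G → ℝ≥0∞) :
    ν.withDensity (fun x => f (-x)) = (ν.withDensity f).neg := by
  ext s hs
  rw [Measure.neg_apply, withDensity_apply _ hs, withDensity_apply _ hs.neg]
  have := (Measure.measurePreserving_neg ν).setLIntegral_comp_preimage_emb
    (MeasurableEquiv.neg G).measurableEmbedding f (-s)
  rwa [Set.neg_preimage, neg_neg] at this

theorem ae_eq_comp_neg {G : Type*} [MeasurableSpace G] [InvolutiveNeg G] [MeasurableNeg G]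
    {ν : Measure G} [ν.IsNegInvariant] {f : G → ℝ≥0∞} (hf : Measurable f)
    [IsFiniteMeasure (ν.withDensity f)] [(ν.withDensity f).IsNegInvariant] :
    f =ᵐ[ν] fun x => f (-x) := by
  have h_lintegral : ∫⁻ x, f x ∂ν ≠ ∞ := by
    simpa using measure_ne_top (ν.withDensity f) univ
  refine (withDensity_eq_iff hf.aemeasurable (hf.comp measurable_neg).aemeasurable
    h_lintegral).1 ?_
  rw [Function.comp_def, withDensity_comp_neg, Measure.neg_eq_self]

variable {E : Type*} [NormedAddCommGroup E] [NormedSpace ℝ E] [FiniteDimensional ℝ E]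
  [MeasurableSpace E] [BorelSpace E]

theorem setLIntegral_image_homothety (ν : Measure E) [ν.IsAddHaarMeasure] (x : E) {r : ℝ}
    (hr : 0 < r) (K : Set E) (f : E → ℝ≥0∞) :
    ∫⁻ y in AffineMap.homothety x r '' K, f y ∂ν =
      ENNReal.ofReal (r ^ Module.finrank ℝ E) *
        ∫⁻ y in K, f (AffineMap.homothety x r y) ∂ν := by
  let φ : E ≃ₜ E := (AffineEquiv.toContinuousAffineEquiv
    (AffineEquiv.homothetyUnitsMulHom x (Units.mk0 r hr.ne'))).toHomeomorph
  have hφ : ⇑φ = AffineMap.homothety x r := rfl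
  have hν : ν = ENNReal.ofReal (r ^ Module.finrank ℝ E) • ν.map φ := by
    ext s -
    rw [Measure.smul_apply, φ.measurableEmbedding.map_apply, smul_eq_mul]
    conv_lhs => rw [← image_preimage_eq s φ.surjective, hφ, Measure.addHaar_image_homothety,
      abs_of_pos (by positivity)]
    rw [hφ]
  rw [← hφ]
  conv_lhs => rw [hν]
  rw [Measure.restrict_smul, lintegral_smul_measure, smul_eq_mul,
    φ.measurableEmbedding.restrict_map, φ.measurableEmbedding.lintegral_map,
    preimage_image_eq _ φ.injective]

theorem lintegral_eq_mul_lintegral_comp_smul (ν : Measure E) [ν.IsAddHaarMeasure] {r : ℝ}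
    (hr : 0 < r) (f : E → ℝ≥0∞) :
    ∫⁻ y, f y ∂ν = ENNReal.ofReal (r ^ Module.finrank ℝ E) * ∫⁻ y, f (r • y) ∂ν := by
  have h_homothety : ⇑(AffineMap.homothety (0 : E) r) = (r • ·) := by
    ext y
    simp [AffineMap.homothety_apply]
  simpa only [h_homothety, image_smul, smul_set_univ₀ hr.ne', Measure.restrict_univ] using
    setLIntegral_image_homothety ν 0 hr univ f

end MeasureTheory

section GibbsDensity

variable {α : Type*} {D : Set α} {V : α → ℝ}

/-- The Gibbs density `exp (-V)` of a potential `V` which is finite exactly on `D`; the values of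
`V` outside `D` are ignored, and the density vanishes there. -/
noncomputable def gibbsDensity (D : Set α) (V : α → ℝ) : α → ℝ≥0∞ :=
  D.indicator fun x => ENNReal.ofReal (Real.exp (-V x))

theorem gibbsDensity_of_mem {x : α} (hx : x ∈ D) :
    gibbsDensity D V x = ENNReal.ofReal (Real.exp (-V x)) :=
  indicator_of_mem hx _

theorem gibbsDensity_of_notMem {x : α} (hx : x ∉ D) : gibbsDensity D V x = 0 :=
  indicator_of_notMem hx _

theorem measurable_gibbsDensity [TopologicalSpace α] [MeasurableSpace α] [OpensMeasurableSpace α]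
    (hD : IsOpen D) (hV : ContinuousOn V D) : Measurable (gibbsDensity D V) := by
  classical
  rw [gibbsDensity, ← piecewise_eq_indicator]
  refine ContinuousOn.measurable_piecewise ?_ continuousOn_const hD.measurableSet
  exact ENNReal.continuous_ofReal.comp_continuousOn (Real.continuous_exp.comp_continuousOn hV.neg)

/-- The even part of a potential, whose Gibbs density is the geometric mean of the density of `V`
and the reflected one. -/
noncomputable def evenPart [Neg α] (V : α → ℝ) (x : α) : ℝ := (V x + V (-x)) / 2

theorem gibbsDensity_evenPart [Neg α] {x : α}
    (hx : gibbsDensity D V x = gibbsDensity D V (-x)) :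
    gibbsDensity (D ∩ -D) (evenPart V) x = gibbsDensity D V x := by
  by_cases h : x ∈ D <;> by_cases h_neg : -x ∈ D
  · rw [gibbsDensity_of_mem h, gibbsDensity_of_mem h_neg,
      ENNReal.ofReal_eq_ofReal_iff (Real.exp_nonneg _) (Real.exp_nonneg _), Real.exp_eq_exp,
      neg_inj] at hx
    rw [gibbsDensity_of_mem (mem_inter h (Set.mem_neg.2 h_neg)), gibbsDensity_of_mem h, evenPart,
      ← hx, add_self_div_two]
  · rw [gibbsDensity_of_notMem fun hmem => h_neg hmem.2, hx, gibbsDensity_of_notMem h_neg]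
  all_goals rw [gibbsDensity_of_notMem fun hmem => h hmem.1, gibbsDensity_of_notMem h]

end GibbsDensity

section EvenPotential

variable {E : Type*} [AddCommGroup E] [Module ℝ E] [TopologicalSpace E] {D : Set E} {V : E → ℝ}

/-- An even convex potential, finite exactly on the nonempty open symmetric set `D`. -/
structure IsEvenPotential (D : Set E) (V : E → ℝ) : Prop where
  isOpen : IsOpen D
  convexOn : ConvexOn ℝ D V
  nonempty : D.Nonempty
  neg_mem : ∀ x ∈ D, -x ∈ D
  even : Function.Even V

namespace IsEvenPotential

theorem zero_mem (h : IsEvenPotential D V) : (0 : E) ∈ D := by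
  obtain ⟨x, hx⟩ := h.nonempty
  have := h.convexOn.1 hx (h.neg_mem x hx) (one_half_pos (α := ℝ)).le one_half_pos.le
    (add_halves 1)
  simpa using this

theorem map_zero_le (h : IsEvenPotential D V) {x : E} (hx : x ∈ D) : V 0 ≤ V x := by
  have := h.convexOn.2 hx (h.neg_mem x hx) (one_half_pos (α := ℝ)).le one_half_pos.le
    (add_halves 1)
  rw [h.even] at this
  simp only [smul_neg, add_neg_cancel, smul_eq_mul] at this
  linarith

theorem smul_mem (h : IsEvenPotential D V) {x : E} (hx : x ∈ D) {r : ℝ} (h0 : 0 ≤ r)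
    (h1 : r ≤ 1) : r • x ∈ D :=
  h.convexOn.1.smul_mem_of_zero_mem h.zero_mem hx ⟨h0, h1⟩

theorem map_smul_le (h : IsEvenPotential D V) {x : E} (hx : x ∈ D) {r : ℝ} (h0 : 0 ≤ r)
    (h1 : r ≤ 1) : V (r • x) ≤ (1 - r) * V 0 + r * V x := by
  have := h.convexOn.2 h.zero_mem hx (sub_nonneg.2 h1) h0 (sub_add_cancel 1 r)
  simpa only [smul_zero, zero_add, smul_eq_mul] using this

theorem mul_le_sub_of_le_map_inv_smul (h : IsEvenPotential D V) {y : E} (hy : y ∈ D) {c s : ℝ}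
    (hs : 1 ≤ s) (hc : V 0 + c ≤ V (s⁻¹ • y)) : c * s ≤ V y - V 0 := by
  have hs0 : 0 < s := one_pos.trans_le hs
  have h_convex := h.map_smul_le hy (inv_nonneg.2 hs0.le) (inv_le_one_of_one_le₀ hs)
  have : c ≤ (V y - V 0) / s := by
    rw [← inv_mul_eq_div]
    linarith
  rwa [le_div_iff₀ hs0] at this

theorem exp_neg_mul_rpow_le (h : IsEvenPotential D V) {y : E} (hy : y ∈ D) {p s : ℝ}
    (hp : 0 ≤ p) (hs : 1 ≤ s) (hV : V 0 + 2 * p ≤ V (s⁻¹ • y)) :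
    Real.exp (-V y) * s ^ p ≤ Real.exp (-p) * Real.exp (-V ((1 / 2 : ℝ) • y)) := by
  have h_growth : 2 * p * s ≤ V y - V 0 := h.mul_le_sub_of_le_map_inv_smul hy hs hV
  have h_half : V ((1 / 2 : ℝ) • y) ≤ (1 - 1 / 2) * V 0 + 1 / 2 * V y :=
    h.map_smul_le hy (by norm_num) (by norm_num)
  have h_rpow : s ^ p ≤ Real.exp ((s - 1) * p) := by
    rw [Real.exp_mul]
    exact Real.rpow_le_rpow (by linarith) (by linarith [Real.add_one_le_exp (s - 1)]) hp
  calc Real.exp (-V y) * s ^ p ≤ Real.exp (-V y) * Real.exp ((s - 1) * p) := by gcongr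
    _ ≤ Real.exp (-p) * Real.exp (-V ((1 / 2 : ℝ) • y)) := by
      rw [← Real.exp_add, ← Real.exp_add, Real.exp_le_exp]
      linarith

theorem gibbsDensity_mul_abs_rpow_le (h : IsEvenPotential D V) {p : ℝ} (hp : 0 ≤ p)
    {l : E →ₗ[ℝ] ℝ} (hl : ∀ y ∈ D, V y < V 0 + 2 * p → |l y| < 1) (y : E) :
    gibbsDensity D V y * ENNReal.ofReal (|l y| ^ p) ≤
      gibbsDensity D V y + ENNReal.ofReal (Real.exp (-p)) * gibbsDensity D V ((1 / 2 : ℝ) • y) := by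
  by_cases hy : y ∈ D
  swap
  · simp [gibbsDensity_of_notMem hy]
  rcases le_total |l y| 1 with hle | hge
  · refine le_add_right (mul_le_of_le_one_right' ?_)
    exact ENNReal.ofReal_le_one.2 (Real.rpow_le_one (abs_nonneg _) hle hp)
  · have hs0 : 0 < |l y| := one_pos.trans_le hge
    have h_large : V 0 + 2 * p ≤ V (|l y|⁻¹ • y) := by
      by_contra! hlt
      have := hl _ (h.smul_mem hy (inv_nonneg.2 hs0.le) (inv_le_one_of_one_le₀ hge)) hlt
      rw [map_smul, smul_eq_mul, abs_mul, abs_inv, abs_abs, inv_mul_cancel₀ hs0.ne'] at this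
      exact lt_irrefl _ this
    refine le_add_left ?_
    rw [gibbsDensity_of_mem hy, gibbsDensity_of_mem (h.smul_mem hy (by norm_num) (by norm_num)),
      ← ENNReal.ofReal_mul (Real.exp_nonneg _), ← ENNReal.ofReal_mul (Real.exp_nonneg _)]
    exact ENNReal.ofReal_le_ofReal (h.exp_neg_mul_rpow_le hy hp hge h_large)

theorem gibbsDensity_le_gibbsDensity_homothety (h : IsEvenPotential D V) {x : E} (hx : x ∈ D)
    {c : ℝ} (hxc : V x ≤ V 0 + c) {r : ℝ} (hr0 : 0 ≤ r) (hr1 : r ≤ 1) (y : E) :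
    ENNReal.ofReal (Real.exp (-(c * (1 - r)))) * gibbsDensity D V y ≤
      gibbsDensity D V (AffineMap.homothety x r y) := by
  by_cases hy : y ∈ D
  swap
  · simp [gibbsDensity_of_notMem hy]
  rw [AffineMap.homothety_eq_lineMap, AffineMap.lineMap_apply_module]
  have h1r : 0 ≤ 1 - r := sub_nonneg.2 hr1
  have hmem : (1 - r) • x + r • y ∈ D := h.convexOn.1 hx hy h1r hr0 (sub_add_cancel 1 r)
  have hle : V ((1 - r) • x + r • y) ≤ V y + c * (1 - r) :=
    calc V ((1 - r) • x + r • y) ≤ (1 - r) * V x + r * V y :=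
          h.convexOn.2 hx hy h1r hr0 (sub_add_cancel 1 r)
      _ ≤ (1 - r) * (V y + c) + r * V y := by
          gcongr
          linarith [h.map_zero_le hy]
      _ = V y + c * (1 - r) := by ring
  rw [gibbsDensity_of_mem hy, gibbsDensity_of_mem hmem, ← ENNReal.ofReal_mul (Real.exp_nonneg _),
    ← Real.exp_add]
  exact ENNReal.ofReal_le_ofReal (Real.exp_le_exp.2 (by linarith))

end IsEvenPotential

theorem isEvenPotential_evenPart [ContinuousNeg E] (hD : IsOpen D) (hV : ConvexOn ℝ D V)
    (hne : (D ∩ -D).Nonempty) : IsEvenPotential (D ∩ -D) (evenPart V) where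
  isOpen := hD.inter hD.neg
  convexOn := by
    have hc : Convex ℝ (D ∩ -D) := hV.1.inter hV.1.neg
    have hV_neg : ConvexOn ℝ (-D) fun x => V (-x) :=
      hV.comp_linearMap (-LinearMap.id)
    have := ((hV.subset inter_subset_left hc).add (hV_neg.subset inter_subset_right hc)).smul
      (one_half_pos (α := ℝ)).le
    refine this.congr fun x _ => ?_
    simp [evenPart, div_eq_inv_mul]
  nonempty := hne
  neg_mem x hx := ⟨hx.2, by simpa using hx.1⟩
  even x := by rw [evenPart, evenPart, neg_neg, add_comm]

end EvenPotential

section HaarMeasure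

variable {E : Type*} [NormedAddCommGroup E] [NormedSpace ℝ E] [FiniteDimensional ℝ E] {D : Set E}
  {V : E → ℝ}

namespace IsEvenPotential

theorem isOpen_sublevel (h : IsEvenPotential D V) (c : ℝ) : IsOpen {x ∈ D | V x < c} :=
  (h.convexOn.continuousOn h.isOpen).isOpen_inter_preimage h.isOpen isOpen_Iio

variable [MeasurableSpace E] [BorelSpace E]

protected theorem measurable_gibbsDensity (h : IsEvenPotential D V) :
    Measurable (gibbsDensity D V) :=
  CentroidPacking.measurable_gibbsDensity h.isOpen (h.convexOn.continuousOn h.isOpen)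

theorem lintegral_abs_rpow_le_two (ν : Measure E) [ν.IsAddHaarMeasure] (h : IsEvenPotential D V)
    [IsProbabilityMeasure (ν.withDensity (gibbsDensity D V))] {p : ℝ}
    (hp : Module.finrank ℝ E ≤ p) {l : StrongDual ℝ E}
    (hl : ∀ y ∈ D, V y < V 0 + 2 * p → |l y| < 1) :
    ∫⁻ y, ENNReal.ofReal (|l y| ^ p) ∂ν.withDensity (gibbsDensity D V) ≤ 2 := by
  have hm := h.measurable_gibbsDensity
  have h_total : ∫⁻ y, gibbsDensity D V y ∂ν = 1 := by
    rw [← setLIntegral_univ, ← withDensity_apply _ MeasurableSet.univ, measure_univ]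
  have h_half : ENNReal.ofReal (Real.exp (-p)) * ∫⁻ y, gibbsDensity D V ((1 / 2 : ℝ) • y) ∂ν ≤ 1 :=
    calc _ ≤ ENNReal.ofReal ((1 / 2) ^ Module.finrank ℝ E) *
            ∫⁻ y, gibbsDensity D V ((1 / 2 : ℝ) • y) ∂ν := by
          gcongr
          have := exp_mul_one_sub_inv_le_pow hp (r := 1 / 2) (by norm_num) (by norm_num)
          rwa [show p * (1 - (1 / 2 : ℝ)⁻¹) = -p by norm_num] at this
      _ = 1 := by rw [← lintegral_eq_mul_lintegral_comp_smul ν (by norm_num), h_total]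
  have hl_meas : Measurable l := l.continuous.measurable
  calc ∫⁻ y, ENNReal.ofReal (|l y| ^ p) ∂ν.withDensity (gibbsDensity D V)
      = ∫⁻ y, gibbsDensity D V y * ENNReal.ofReal (|l y| ^ p) ∂ν :=
        lintegral_withDensity_eq_lintegral_mul _ hm (by fun_prop)
    _ ≤ ∫⁻ y, (gibbsDensity D V y +
          ENNReal.ofReal (Real.exp (-p)) * gibbsDensity D V ((1 / 2 : ℝ) • y)) ∂ν :=
        lintegral_mono
          (h.gibbsDensity_mul_abs_rpow_le ((Nat.cast_nonneg _).trans hp) (l := l.toLinearMap) hl)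
    _ = 1 + ENNReal.ofReal (Real.exp (-p)) * ∫⁻ y, gibbsDensity D V ((1 / 2 : ℝ) • y) ∂ν := by
        rw [lintegral_add_left hm, h_total, lintegral_const_mul' _ _ ENNReal.ofReal_ne_top]
    _ ≤ 1 + 1 := by gcongr
    _ = 2 := one_add_one_eq_two

theorem integral_abs_rpow_le_two (ν : Measure E) [ν.IsAddHaarMeasure] (h : IsEvenPotential D V)
    [IsProbabilityMeasure (ν.withDensity (gibbsDensity D V))] {p : ℝ}
    (hp : Module.finrank ℝ E ≤ p) {l : StrongDual ℝ E}
    (hl : ∀ y ∈ D, V y < V 0 + 2 * p → |l y| < 1) :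
    ∫ y, |l y| ^ p ∂ν.withDensity (gibbsDensity D V) ≤ 2 := by
  have hl_meas : Measurable l := l.continuous.measurable
  have hm : Measurable fun y => |l y| ^ p := by fun_prop
  rw [integral_eq_lintegral_of_nonneg_ae (.of_forall fun y => by positivity)
    hm.aestronglyMeasurable]
  exact ENNReal.toReal_le_of_le_ofReal zero_le_two
    (by simpa using h.lintegral_abs_rpow_le_two ν hp hl)

theorem mul_measure_le_measure_homothety_image (ν : Measure E) [ν.IsAddHaarMeasure]
    (h : IsEvenPotential D V) {x : E} (hx : x ∈ D) {c : ℝ} (hxc : V x ≤ V 0 + c) {r : ℝ}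
    (hr0 : 0 < r) (hr1 : r ≤ 1) (K : Set E) :
    ENNReal.ofReal (r ^ Module.finrank ℝ E * Real.exp (-(c * (1 - r)))) *
        ν.withDensity (gibbsDensity D V) K ≤
      ν.withDensity (gibbsDensity D V) (AffineMap.homothety x r '' K) := by
  rw [withDensity_apply' _ K, withDensity_apply' _ (_ '' K), setLIntegral_image_homothety ν x hr0,
    ENNReal.ofReal_mul (by positivity), mul_assoc,
    ← lintegral_const_mul' _ _ ENNReal.ofReal_ne_top]
  gcongr with y
  exact h.gibbsDensity_le_gibbsDensity_homothety hx hxc hr0.le hr1 y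

end IsEvenPotential

variable [MeasurableSpace E] [BorelSpace E]

theorem gibbsDensity_interior_ae_eq (ν : Measure E) [ν.IsAddHaarMeasure] (hD : Convex ℝ D)
    (V : E → ℝ) : gibbsDensity (interior D) V =ᵐ[ν] gibbsDensity D V :=
  indicator_ae_eq_of_ae_eq_set (interior_ae_eq_of_null_frontier (hD.addHaar_frontier ν))

theorem exists_isEvenPotential_of_isOpen {ν : Measure E} [ν.IsAddHaarMeasure] (hD : IsOpen D)
    (hV : ConvexOn ℝ D V) [IsFiniteMeasure (ν.withDensity (gibbsDensity D V))]
    [NeZero (ν.withDensity (gibbsDensity D V))]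
    [(ν.withDensity (gibbsDensity D V)).IsNegInvariant] :
    ∃ D' V', IsEvenPotential D' V' ∧
      ν.withDensity (gibbsDensity D V) = ν.withDensity (gibbsDensity D' V') := by
  have h_eq : gibbsDensity D V =ᵐ[ν] gibbsDensity (D ∩ -D) (evenPart V) := by
    filter_upwards [ae_eq_comp_neg (ν := ν) (measurable_gibbsDensity hD (hV.continuousOn hD))]
      with x hx using (gibbsDensity_evenPart hx).symm
  have hne : (D ∩ -D).Nonempty := by
    by_contra! hempty
    refine NeZero.ne (ν.withDensity (gibbsDensity D V)) ?_
    rw [withDensity_congr_ae h_eq, hempty, gibbsDensity, indicator_empty, ← Pi.zero_def,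
      withDensity_zero]
  exact ⟨_, _, isEvenPotential_evenPart hD hV hne, withDensity_congr_ae h_eq⟩

theorem exists_isEvenPotential {ν : Measure E} [ν.IsAddHaarMeasure] (hV : ConvexOn ℝ D V)
    {μ : Measure E} [IsFiniteMeasure μ] [NeZero μ] [μ.IsNegInvariant]
    (hμ : μ = ν.withDensity (gibbsDensity D V)) :
    ∃ D' V', IsEvenPotential D' V' ∧ μ = ν.withDensity (gibbsDensity D' V') := by
  rw [← withDensity_congr_ae (gibbsDensity_interior_ae_eq ν hV.1 V)] at hμ
  subst hμ
  exact exists_isEvenPotential_of_isOpen isOpen_interior (hV.subset interior_subset hV.1.interior)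

end HaarMeasure

section Packing

variable {n : ℕ}

theorem apply_le_of_mem_centroidBody {μ : Measure (EuclideanSpace ℝ (Fin n))} {p : ℝ}
    {x : EuclideanSpace ℝ (Fin n)} (hx : x ∈ centroidBody p μ)
    (l : StrongDual ℝ (EuclideanSpace ℝ (Fin n))) : l x ≤ (∫ y, |l y| ^ p ∂μ) ^ (1 / p) := by
  have h_inner : ∀ y, inner ℝ y ((InnerProductSpace.toDual ℝ _).symm l) = l y := fun y => by
    rw [real_inner_comm, InnerProductSpace.toDual_symm_apply]
  simpa only [h_inner] using hx ((InnerProductSpace.toDual ℝ _).symm l)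

theorem IsEvenPotential.third_smul_mem_of_mem_centroidBody
    {D : Set (EuclideanSpace ℝ (Fin n))} {V : EuclideanSpace ℝ (Fin n) → ℝ}
    (h : IsEvenPotential D V) [IsProbabilityMeasure (volume.withDensity (gibbsDensity D V))]
    {p : ℝ} (hnp : n ≤ p) {x : EuclideanSpace ℝ (Fin n)}
    (hx : x ∈ centroidBody p (volume.withDensity (gibbsDensity D V))) :
    (1 / 3 : ℝ) • x ∈ D ∧ V ((1 / 3 : ℝ) • x) ≤ V 0 + 2 * p := by
  rcases Nat.eq_zero_or_pos n with rfl | hn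
  · rw [Subsingleton.elim ((1 / 3 : ℝ) • x) 0]
    exact ⟨h.zero_mem, by simpa using hnp⟩
  have hp : 1 ≤ p := le_trans (by exact_mod_cast hn) hnp
  suffices hmem : (1 / 3 : ℝ) • x ∈ {y ∈ D | V y < V 0 + 2 * p} from ⟨hmem.1, hmem.2.le⟩
  by_contra h_notMem
  obtain ⟨l, hlx, hl⟩ := exists_eq_one_forall_abs_lt_one (h.convexOn.convex_lt (V 0 + 2 * p))
    (h.isOpen_sublevel _) ⟨h.zero_mem, by linarith⟩
    (fun y hy => ⟨h.neg_mem y hy.1, (h.even y).trans_lt hy.2⟩) h_notMem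
  have h_moment := h.integral_abs_rpow_le_two volume (p := p) (by simpa using hnp)
    fun y hy hVy => hl y ⟨hy, hVy⟩
  have hlx_le : l x ≤ 2 :=
    calc l x ≤ (∫ y, |l y| ^ p ∂volume.withDensity (gibbsDensity D V)) ^ (1 / p) :=
          apply_le_of_mem_centroidBody hx l
      _ ≤ 2 ^ (1 / p) := by
          gcongr
      _ ≤ 2 ^ (1 : ℝ) :=
          Real.rpow_le_rpow_of_exponent_le one_le_two ((div_le_one (by linarith)).2 hp)
      _ = 2 := Real.rpow_one 2
  rw [map_smul, smul_eq_mul] at hlx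
  linarith

theorem packing_mul_le_measure_univ (μ : Measure (EuclideanSpace ℝ (Fin n)))
    {A B : Set (EuclideanSpace ℝ (Fin n))} (hB : MeasurableSet B) {r : ℝ} (hr : r ≠ 0) {c : ℝ≥0∞}
    (hc : ∀ x ∈ A, c ≤ μ (r • (x +ᵥ B))) : (packing A B : ℝ≥0∞) * c ≤ μ univ := by
  simp only [packing, ENat.toENNReal_iSup, ENNReal.iSup_mul]
  refine iSup_le fun S => iSup_le fun hS => iSup_le fun hd => ?_
  refine encard_mul_le_measure_univ μ (A := fun x => r • (x +ᵥ B))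
    (fun x => (hB.const_vadd x).const_smul₀ r) (fun x hx y hy hxy => ?_) fun x hx => hc x (hS hx)
  exact (disjoint_image_iff (smul_right_injective _ hr)).2 (hd hx hy hxy)

theorem packing_centroidBody_le {μ : Measure (EuclideanSpace ℝ (Fin n))} [IsProbabilityMeasure μ]
    [μ.IsNegInvariant] (hμ : IsLogConcave μ) {p : ℝ} (hnp : n ≤ p)
    {K : Set (EuclideanSpace ℝ (Fin n))} (hK : MeasurableSet K) {t q : ℝ} (ht : 0 < t)
    (hq : ENNReal.ofReal (Real.exp (-q)) ≤ μ K) :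
    (packing (centroidBody p μ) ((9 * t) • K) : ℝ≥0∞) ≤
      ENNReal.ofReal (Real.exp (q + p / t)) := by
  obtain ⟨D₀, V₀, hV₀, hμ₀⟩ := hμ
  obtain ⟨D, V, h, rfl⟩ := exists_isEvenPotential hV₀ hμ₀
  set r : ℝ := 3 * t / (1 + 3 * t) with hr
  have hr0 : 0 < r := by positivity
  have h1r : 1 - r = 1 / (1 + 3 * t) := by rw [hr]; field_simp; ring
  have h1r0 : 0 < 1 - r := by rw [h1r]; positivity
  have h_scale : (1 - r) * (1 / 3) * (9 * t) = r := by rw [h1r, hr]; ring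
  have h_piece : ∀ x ∈ centroidBody p (volume.withDensity (gibbsDensity D V)),
      ENNReal.ofReal (Real.exp (-(q + p / t))) ≤
        volume.withDensity (gibbsDensity D V) (((1 - r) * (1 / 3)) • (x +ᵥ (9 * t) • K)) := by
    intro x hx
    obtain ⟨hxD, hxV⟩ := h.third_smul_mem_of_mem_centroidBody hnp hx
    rw [← homothety_smul_image h_scale]
    refine le_trans ?_
      (h.mul_measure_le_measure_homothety_image volume hxD hxV hr0 (sub_pos.1 h1r0).le K)
    rw [finrank_euclideanSpace_fin, neg_add_rev, Real.exp_add,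
      ENNReal.ofReal_mul (Real.exp_nonneg _)]
    gcongr
    exact exp_neg_div_le_pow_mul_exp hnp ht hr
  have h_pack := packing_mul_le_measure_univ _ (hK.const_smul₀ (9 * t))
    (mul_pos h1r0 (by norm_num : (0 : ℝ) < 1 / 3)).ne' h_piece
  rwa [measure_univ, ← ENNReal.le_div_iff_mul_le (by simp [Real.exp_pos]) (by simp), one_div,
    ← ENNReal.ofReal_inv_of_pos (Real.exp_pos _), ← Real.exp_neg, neg_neg] at h_pack

end Packing

theorem isClosed_setOf_mem_smul {M X : Type*} [TopologicalSpace M] [TopologicalSpace X] [T1Space X]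
    [SMul M X] [ContinuousSMul M X] {L : Set X} (hL : IsCompact L) (x : X) :
    IsClosed {s : M | x ∈ s • L} := by
  have : CompactSpace L := isCompact_iff_compactSpace.1 hL
  have h_eq : {s : M | x ∈ s • L} = Prod.fst '' {a : M × L | a.1 • (a.2 : X) = x} := by
    ext s
    simp [mem_smul_set]
  rw [h_eq]
  exact isClosedMap_fst_of_compactSpace _ (isClosed_singleton.preimage (by fun_prop))

namespace IsStarBody

variable {n : ℕ} {L : Set (EuclideanSpace ℝ (Fin n))}

theorem smul_subset_smul (hL : IsStarBody L) {r s : ℝ} (hr : 0 ≤ r) (hrs : r ≤ s) :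
    r • L ⊆ s • L := by
  rcases (hr.trans hrs).eq_or_lt with rfl | hs
  · rw [hrs.antisymm hr]
  · calc r • L = s • (r / s) • L := by rw [smul_smul, mul_div_cancel₀ _ hs.ne']
      _ ⊆ s • L := smul_set_mono (hL.smul_subset (r / s) ⟨by positivity, (div_le_one hs).2 hrs⟩)

theorem iUnion_natCast_smul (hL : IsStarBody L) : ⋃ k : ℕ, (k : ℝ) • L = univ := by
  refine eq_univ_of_forall fun x => ?_
  have h_absorbs : Absorbs ℝ L {x} :=
    absorbent_nhds_zero (mem_interior_iff_mem_nhds.1 hL.zero_mem_interior) x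
  obtain ⟨r, -, hr⟩ := h_absorbs.exists_pos
  obtain ⟨k, hk⟩ := exists_nat_ge r
  exact mem_iUnion.2 ⟨k, hr k (by simpa using hk) rfl⟩

variable (μ : Measure (EuclideanSpace ℝ (Fin n)))

theorem bddAbove_setOf_measure_smul_le (hL : IsStarBody L) {c : ℝ≥0∞} (hc : c < μ univ) :
    BddAbove {s : ℝ | 0 < s ∧ μ (s • L) ≤ c} := by
  have h_tendsto := tendsto_measure_iUnion_atTop (μ := μ) (s := fun k : ℕ => (k : ℝ) • L)
    fun i j hij => hL.smul_subset_smul (by positivity) (by exact_mod_cast hij)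
  rw [hL.iUnion_natCast_smul] at h_tendsto
  obtain ⟨k, hk⟩ := (h_tendsto.eventually_const_lt hc).exists
  refine ⟨k, fun s ⟨_, hs⟩ => ?_⟩
  by_contra! hks
  exact (hk.trans_le (measure_mono (hL.smul_subset_smul k.cast_nonneg hks.le))).not_ge hs

theorem le_measure_smul_of_forall_gt [IsFiniteMeasure μ] (hL : IsStarBody L) {c : ℝ≥0∞} {r : ℝ}
    (hr : 0 ≤ r) (h : ∀ s > r, c ≤ μ (s • L)) : c ≤ μ (r • L) := by
  have h_iInter : ⋂ s > r, s • L ⊆ r • L := fun x hx => by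
    have h_subset : Ioi r ⊆ {s | x ∈ s • L} := fun s hs => mem_iInter₂.1 hx s hs
    have h_closure := (isClosed_setOf_mem_smul hL.isCompact x).closure_subset_iff.2 h_subset
    rw [closure_Ioi] at h_closure
    exact h_closure self_mem_Ici
  have h_tendsto := tendsto_measure_biInter_gt (μ := μ) (s := fun s : ℝ => s • L) (a := r)
    (fun s _ => (hL.isCompact.smul s).measurableSet.nullMeasurableSet)
    (fun i j hi hij => hL.smul_subset_smul (hr.trans hi.le) hij)
    ⟨r + 1, lt_add_one r, measure_ne_top _ _⟩
  exact (ge_of_tendsto h_tendsto (eventually_mem_nhdsWithin.mono h)).trans (measure_mono h_iInter)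

theorem le_measure_quantile_smul [IsProbabilityMeasure μ] (hL : IsStarBody L) {q : ℝ} (hq : 0 < q) :
    ENNReal.ofReal (Real.exp (-q)) ≤ μ (quantile q μ L • L) := by
  have h_nonneg : 0 ≤ quantile q μ L := Real.sSup_nonneg fun s hs => hs.1.le
  have h_lt : ENNReal.ofReal (Real.exp (-q)) < μ univ := by
    rwa [measure_univ, ENNReal.ofReal_lt_one, Real.exp_lt_one_iff, neg_lt_zero]
  refine hL.le_measure_smul_of_forall_gt μ h_nonneg fun s hs => ?_
  by_contra! hlt
  exact (le_csSup (hL.bddAbove_setOf_measure_smul_le μ h_lt)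
    ⟨h_nonneg.trans_lt hs, hlt.le⟩).not_gt hs

end IsStarBody

end CentroidPacking

theorem theorem4p1 :
    ∃ C : ℝ, 0 < C ∧
      ∀ (n : ℕ) (μ : Measure (EuclideanSpace ℝ (Fin n))) [IsProbabilityMeasure μ]
        [μ.IsNegInvariant], CentroidPacking.IsLogConcave μ →
      ∀ L : Set (EuclideanSpace ℝ (Fin n)), CentroidPacking.IsStarBody L →
      ∀ p : ℝ, (n : ℝ) ≤ p →
        (∀ t q : ℝ, 0 < t → 0 < q →
          (CentroidPacking.packing (CentroidPacking.centroidBody p μ)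
              ((C * t * CentroidPacking.quantile q μ L) • L) : ℝ≥0∞) ≤
            ENNReal.ofReal (Real.exp (1 + q + p / t))) ∧
        (ENNReal.ofReal (Real.exp (-p)) ≤ μ L →
          (CentroidPacking.packing (CentroidPacking.centroidBody p μ) (C • L) : ℝ≥0∞) ≤
            ENNReal.ofReal (Real.exp (3 * p))) := by
  refine ⟨9, by norm_num, fun n μ _ _ hμ L hL p hnp => ⟨fun t q ht hq => ?_, fun hLp => ?_⟩⟩
  · have h_pack := CentroidPacking.packing_centroidBody_le hμ hnp
      (hL.isCompact.smul _).measurableSet ht (hL.le_measure_quantile_smul μ hq)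
    rw [smul_smul] at h_pack
    exact h_pack.trans (by gcongr; linarith)
  · have h_pack := CentroidPacking.packing_centroidBody_le hμ hnp
      hL.isCompact.measurableSet one_pos hLp
    rw [mul_one, div_one] at h_pack
    exact h_pack.trans (by gcongr; linarith [n.cast_nonneg.trans hnp])
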